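/- Let $H$ be a complex Hilbert space, let $\mathcal L(H)$ be the algebra of bounded linear operators on $H$, let $\mathcal M\subset\mathcal L(H)$ be a von Neumann algebra (a $*$-subalgebra with $\mathcal M=\mathcal M''$), and let $M\in\mathcal M$. (i) Put $|M|:=(M^*M)^{1/2}$. There is exactly one partial isometry $V\in\mathcal L(H)$ with $M=V|M|$ and $\ker V=\ker M$ (the polar decomposition of $M$), and both $V$ and $|M|$ lie in $\mathcal M$. (ii) If $M=M^*$, there is exactly one projection-valued measure $E_M$ on the Borel sets of $\mathbb R$, countably additive in the strong operator topology and with $E_M(\mathbb R)=\mathbb 1$, such that $M=\int\lambda\,dE_M(\lambda)$; that is, for every $x\in H$, $\int\lambda^2\,d\langle x,E_M(\lambda)x\rangle<\infty$ and $\langle x,Mx\rangle=\int\lambda\,d\langle x,E_M(\lambda)x\rangle$. All spectral projections $E_M(B)$, $B\subset\mathbb R$ Borel, lie in $\mathcal M$. (iii) If $M=M^*$ and $f$ is a complex-valued function continuous on $[-\|M\|,\|M\|]$, let $f(M)\in\mathcal L(H)$ be given by the continuous functional calculus. Let $\mathcal A\subset\mathcal L(H)$ be any C*-algebra (a norm-closed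 $*$-subalgebra, not assumed to contain the identity operator) with $M\in\mathcal A$. If $\mathbb 1\in\mathcal A$ or $f(0)=0$, then $f(M)\in\mathcal A$. In particular, for every such $f$ (with no condition on $f(0)$), $f(M)\in\mathcal M$. -/

import Mathlib

open scoped InnerProductSpace
open MeasureTheory

/-- `V` is a partial isometry: it is isometric on the orthogonal complement of its kernel. -/
def IsPartialIsometry {H : Type*} [NormedAddCommGroup H] [InnerProductSpace ℂ H]
    (V : H →L[ℂ] H) : Prop :=
  ∀ x ∈ V.kerᗮ, ‖V x‖ = ‖x‖

/-- `V` is the partial isometry of the polar decomposition `T = V |T|`, where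
`|T| = (T* T)^{1/2}` is `CFC.abs T` and `ker V = ker T`. -/
structure IsPolarFactor {H : Type*} [NormedAddCommGroup H] [InnerProductSpace ℂ H]
    [CompleteSpace H] (T V : H →L[ℂ] H) : Prop where
  isPartialIsometry : IsPartialIsometry V
  eq_mul_abs : T = V * CFC.abs T
  ker_eq : V.ker = T.ker

/-- A projection-valued measure on the Borel sets of `ℝ`, countably additive in the strong
operator topology. As for `MeasureTheory.VectorMeasure`, the value on a set that is not Borel is
set to `0`, so that two such measures are equal iff they agree on Borel sets. -/
structure SpectralMeasure (H : Type*) [NormedAddCommGroup H] [InnerProductSpace ℂ H]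
    [CompleteSpace H] where
  proj : Set ℝ → H →L[ℂ] H
  isStarProjection : ∀ B, MeasurableSet B → IsStarProjection (proj B)
  proj_empty : proj ∅ = 0
  proj_univ : proj Set.univ = 1
  proj_inter : ∀ A B, MeasurableSet A → MeasurableSet B → proj (A ∩ B) = proj A * proj B
  hasSum_proj : ∀ B : ℕ → Set ℝ, (∀ n, MeasurableSet (B n)) → Pairwise (Function.onFun Disjoint B) →
    ∀ x : H, HasSum (fun n => proj (B n) x) (proj (⋃ n, B n) x)
  proj_of_not_measurable : ∀ B, ¬ MeasurableSet B → proj B = 0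

namespace SpectralMeasure

variable {H : Type*} [NormedAddCommGroup H] [InnerProductSpace ℂ H] [CompleteSpace H]

theorem re_inner_nonneg (E : SpectralMeasure H) (x : H) {B : Set ℝ} (hB : MeasurableSet B) :
    0 ≤ (⟪x, E.proj B x⟫_ℂ).re := by
  have h := (ContinuousLinearMap.IsPositive.of_isStarProjection (E.isStarProjection B hB))
  exact h.re_inner_nonneg_right x

/-- The scalar measure `B ↦ ⟨x, E(B) x⟩`. -/
noncomputable def scalarMeasure (E : SpectralMeasure H) (x : H) : Measure ℝ :=
  Measure.ofMeasurable (fun B _ => ENNReal.ofReal (⟪x, E.proj B x⟫_ℂ).re)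
    (by simp [E.proj_empty])
    (by
      intro B hB hd
      have h1 := Complex.hasSum_re ((E.hasSum_proj B hB hd x).mapL (innerSL ℂ x))
      have h2 : HasSum (fun n => (⟪x, E.proj (B n) x⟫_ℂ).re) (⟪x, E.proj (⋃ n, B n) x⟫_ℂ).re := h1
      rw [← h2.tsum_eq]
      exact ENNReal.ofReal_tsum_of_nonneg (fun n => E.re_inner_nonneg x (hB n)) h2.summable)

/-- `T = ∫ λ dE(λ)` as an operator with domain all of `H`: every vector lies in the domain
`{x | ∫ λ² d⟨x, E(λ) x⟩ < ∞}`, and `⟨x, T x⟩ = ∫ λ d⟨x, E(λ) x⟩` (which determines `T` by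
polarization). -/
def IsSpectralDecompositionOf (E : SpectralMeasure H) (T : H →L[ℂ] H) : Prop :=
  ∀ x : H, Integrable (fun t : ℝ => t ^ 2) (E.scalarMeasure x) ∧
    ⟪x, T x⟫_ℂ = ((∫ t : ℝ, t ∂(E.scalarMeasure x) : ℝ) : ℂ)

end SpectralMeasure

/-- `f(T)` for a self-adjoint operator `T` and a complex function `f` that is continuous on
`[-‖T‖, ‖T‖]`: the continuous functional calculus of `T`. As the spectrum of `T` is real,
`z ↦ f (re z)` is `f` on it. -/
noncomputable def continuousFunctionOf {H : Type*} [NormedAddCommGroup H] [InnerProductSpace ℂ H]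
    [CompleteSpace H] (f : ℝ → ℂ) (T : H →L[ℂ] H) : H →L[ℂ] H :=
  cfc (fun z : ℂ => f z.re) T

/-! Since `𝓜 = 𝓜''`, an operator lies in `𝓜` once it commutes with the commutant. Elements of the
commutant commute with `M` and `star M`, so it suffices that every object built from `M` inherits
this commutation.

Polar decomposition: `|M| x ↦ M x` is isometric and extends to the closure of the range of `|M|`;
extended by zero on `ker M`, it is the only candidate. The same rigidity gives commutation.

Existence of the spectral measure (`exists_spectral_operator`, `cfcProj_inter`): Riesz–Markov turns
`f ↦ ⟨x, f(M) x⟩` into a measure `μ_x`. Weak limits, starting from continuous functions, produce for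
each Borel `B` a positive operator with form `μ_x(B)`. Multiplicativity follows from `μ_{√P_B x} =
μ_x|_B`, and idempotence follows from multiplicativity.

Uniqueness (`IsSpectralDecompositionOf.unique`): for `a < b` and low enough `c`, powers of `M - c`
grow at rate at most `a - c` on the range of `E(-∞, a]` and at least `b - c` on that of `F(b, ∞)`,
which forces `F(b, ∞) E(-∞, a] = 0`. Hence half-lines get equal projections.

Continuous functions of `M` lie in the closed star algebra generated by `M`, unital or not; `f 0 =
0` permits the non-unital calculus. -/

/-! ### Membership through the bicommutant. -/

section CentralizerMembership

variable {H : Type*} [NormedAddCommGroup H] [InnerProductSpace ℂ H] [CompleteSpace H]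

theorem VonNeumannAlgebra.mem_iff_forall_commute {S : VonNeumannAlgebra H} {T : H →L[ℂ] H} :
    T ∈ S ↔ ∀ A ∈ S.commutant, Commute A T := by
  conv_lhs => rw [← VonNeumannAlgebra.commutant_commutant S]
  exact VonNeumannAlgebra.mem_commutant_iff

theorem VonNeumannAlgebra.commute_of_mem_commutant {S : VonNeumannAlgebra H} {A T : H →L[ℂ] H}
    (hA : A ∈ S.commutant) (hT : T ∈ S) : Commute A T :=
  VonNeumannAlgebra.mem_iff_forall_commute.1 hT A hA

theorem VonNeumannAlgebra.abs_mem {S : VonNeumannAlgebra H} {T : H →L[ℂ] H} (hT : T ∈ S) :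
    CFC.abs T ∈ S :=
  VonNeumannAlgebra.mem_iff_forall_commute.2 fun _ hA =>
    (Commute.cfcAbs_left (commute_of_mem_commutant hA hT).symm
      (commute_of_mem_commutant (star_mem hA) hT).symm).symm

end CentralizerMembership

/-! ### Continuous functional calculus inside an algebra. -/

section ContinuousFunction

variable {H : Type*} [NormedAddCommGroup H] [InnerProductSpace ℂ H] [CompleteSpace H]

theorem VonNeumannAlgebra.continuousFunctionOf_mem {S : VonNeumannAlgebra H} {T : H →L[ℂ] H}
    (hT : T ∈ S) (f : ℝ → ℂ) : continuousFunctionOf f T ∈ S :=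
  VonNeumannAlgebra.mem_iff_forall_commute.2 fun _ hA =>
    (Commute.cfc (commute_of_mem_commutant hA hT).symm
      (commute_of_mem_commutant hA (star_mem hT)).symm _).symm

theorem re_mem_Icc_of_mem_spectrum {T : H →L[ℂ] H} {z : ℂ} (hz : z ∈ spectrum ℂ T) :
    z.re ∈ Set.Icc (-‖T‖) ‖T‖ := by
  cases subsingleton_or_nontrivial (H →L[ℂ] H) with
  | inl h => simp [spectrum.of_subsingleton] at hz
  | inr h => exact abs_le.1 ((Complex.abs_re_le_norm z).trans (spectrum.norm_le_norm_of_mem hz))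

theorem continuousFunctionOf_mem_of_one_mem {T : H →L[ℂ] H} (f : ℝ → ℂ)
    {A : NonUnitalStarSubalgebra ℂ (H →L[ℂ] H)} (hA : IsClosed (A : Set (H →L[ℂ] H)))
    (hT : T ∈ A) (h1 : 1 ∈ A) : continuousFunctionOf f T ∈ A :=
  (StarAlgebra.elemental.le_of_mem (S := A.toStarSubalgebra h1) hA hT) (cfc_mem_elemental _ T)

theorem continuousFunctionOf_mem_of_apply_zero {T : H →L[ℂ] H} {f : ℝ → ℂ}
    (hf : ContinuousOn f (Set.Icc (-‖T‖) ‖T‖)) (h0 : f 0 = 0)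
    {A : NonUnitalStarSubalgebra ℂ (H →L[ℂ] H)} (hA : IsClosed (A : Set (H →L[ℂ] H)))
    (hT : T ∈ A) : continuousFunctionOf f T ∈ A := by
  have hc : ContinuousOn (fun z : ℂ => f z.re) (quasispectrum ℂ T) := by
    refine hf.comp Complex.continuous_re.continuousOn fun z hz => ?_
    rw [quasispectrum_eq_spectrum_union_zero] at hz
    rcases hz with hz | rfl
    · exact re_mem_Icc_of_mem_spectrum hz
    · simp
  -- The quasispectrum adds the point `0`, which also lies in the interval where `f` is continuous.
  rw [continuousFunctionOf, ← cfcₙ_eq_cfc hc (by simpa using h0)]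
  exact (NonUnitalStarAlgebra.elemental.le_of_mem hA hT) (cfcₙ_mem_elemental _ T)

end ContinuousFunction

/-! ### Polar decomposition. -/

section PolarDecomposition

variable {H : Type*} [NormedAddCommGroup H] [InnerProductSpace ℂ H] [CompleteSpace H]

theorem norm_abs_apply (T : H →L[ℂ] H) (x : H) : ‖CFC.abs T x‖ = ‖T x‖ := by
  have h : IsSelfAdjoint (CFC.abs T) := (CFC.abs_nonneg T).isSelfAdjoint
  have h2 : ⟪CFC.abs T x, CFC.abs T x⟫_ℂ = ⟪T x, T x⟫_ℂ := by
    rw [← ContinuousLinearMap.adjoint_inner_right, ← ContinuousLinearMap.star_eq_adjoint, h.star_eq,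
      ← mul_apply_eq_comp, CFC.abs_mul_abs, mul_apply_eq_comp,
      ContinuousLinearMap.star_eq_adjoint, ContinuousLinearMap.adjoint_inner_right]
  rw [inner_self_eq_norm_sq_to_K, inner_self_eq_norm_sq_to_K] at h2
  have h3 : ‖CFC.abs T x‖ ^ 2 = ‖T x‖ ^ 2 := by exact_mod_cast h2
  exact (sq_eq_sq₀ (norm_nonneg _) (norm_nonneg _)).1 h3

theorem ker_abs (T : H →L[ℂ] H) : (CFC.abs T).ker = T.ker := by
  ext x
  rw [LinearMap.mem_ker, LinearMap.mem_ker, ContinuousLinearMap.coe_coe,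
    ContinuousLinearMap.coe_coe, ← norm_eq_zero, norm_abs_apply, norm_eq_zero]

theorem IsSelfAdjoint.orthogonal_topologicalClosure_range {N : H →L[ℂ] H} (hN : IsSelfAdjoint N) :
    N.range.topologicalClosureᗮ = N.ker := by
  rw [Submodule.orthogonal_closure, ContinuousLinearMap.orthogonal_range,
    ← ContinuousLinearMap.star_eq_adjoint, hN.star_eq]

/-- `H` is the orthogonal sum of the closed range and the kernel of `N`. This rigidity serves both
uniqueness and commutation of the polar factor. -/
theorem IsSelfAdjoint.ext_of_mul_eq_of_eqOn_ker {N S T : H →L[ℂ] H} (hN : IsSelfAdjoint N)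
    (hr : S * N = T * N) (hk : ∀ x ∈ N.ker, S x = T x) : S = T := by
  have hcl : ∀ x ∈ N.range.topologicalClosure, S x = T x := by
    intro x hx
    have : closure (N.range : Set H) ⊆ {x | S x = T x} := by
      refine closure_minimal ?_ (isClosed_eq S.continuous T.continuous)
      rintro _ ⟨y, rfl⟩
      exact congr($hr y)
    exact this hx
  ext x
  have : CompleteSpace N.range.topologicalClosure :=
    (Submodule.isClosed_topologicalClosure _).completeSpace_coe
  obtain ⟨y, hy, z, hz, rfl⟩ := N.range.topologicalClosure.exists_add_mem_mem_orthogonal x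
  rw [hN.orthogonal_topologicalClosure_range] at hz
  rw [map_add, map_add, hcl y hy, hk z hz]

theorem IsPolarFactor.unique {T V W : H →L[ℂ] H} (hV : IsPolarFactor T V)
    (hW : IsPolarFactor T W) : V = W := by
  refine (CFC.abs_nonneg T).isSelfAdjoint.ext_of_mul_eq_of_eqOn_ker
    (hV.eq_mul_abs.symm.trans hW.eq_mul_abs) fun x hx => ?_
  rw [ker_abs] at hx
  have h1 : x ∈ V.ker := hV.ker_eq ▸ hx
  have h2 : x ∈ W.ker := hW.ker_eq ▸ hx
  exact (LinearMap.mem_ker.1 h1).trans (LinearMap.mem_ker.1 h2).symm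

/-- `A V` and `V A` agree after right multiplication by `|T|`, and both vanish on `ker T` because
`A` preserves it. -/
theorem IsPolarFactor.commute {T V A : H →L[ℂ] H} (hV : IsPolarFactor T V) (h : Commute A T)
    (h' : Commute A (star T)) : Commute A V := by
  have habs : Commute A (CFC.abs T) := by
    refine (Commute.cfcAbs_left h.symm ?_).symm
    simpa using h'.symm.star_star
  refine (CFC.abs_nonneg T).isSelfAdjoint.ext_of_mul_eq_of_eqOn_ker ?_ fun x hx => ?_
  · rw [mul_assoc, mul_assoc, habs.eq, ← mul_assoc V, ← hV.eq_mul_abs, h.eq]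
  · rw [ker_abs] at hx
    have hA : A x ∈ T.ker := by
      have : T (A x) = A (T x) := congr($h.eq.symm x)
      have hx' : T x = 0 := hx
      rw [LinearMap.mem_ker, ContinuousLinearMap.coe_coe, this, hx', map_zero]
    rw [← hV.ker_eq] at hx hA
    have hx' : V x = 0 := hx
    have hA' : V (A x) = 0 := hA
    simp [hx', hA']

theorem exists_isPolarFactor (T : H →L[ℂ] H) : ∃ V, IsPolarFactor T V := by
  set N := CFC.abs T with hN
  have hsa : IsSelfAdjoint N := (CFC.abs_nonneg T).isSelfAdjoint
  set K := N.range.topologicalClosure with hK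
  have : CompleteSpace K := (Submodule.isClosed_topologicalClosure _).completeSpace_coe
  let e : H →ₗ[ℂ] K := (N : H →ₗ[ℂ] H).codRestrict K fun x =>
    Submodule.le_topologicalClosure _ ⟨x, rfl⟩
  have he : ∀ x, (e x : H) = N x := fun x => rfl
  have hd : DenseRange e := by
    intro y
    rw [closure_subtype]
    have : (Subtype.val '' Set.range e : Set H) = (N.range : Set H) := by
      ext z
      constructor
      · rintro ⟨_, ⟨x, rfl⟩, rfl⟩
        exact ⟨x, rfl⟩
      · rintro ⟨x, rfl⟩
        exact ⟨e x, ⟨x, rfl⟩, rfl⟩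
    rw [this]
    exact y.2
  have hbd : ∀ x, ‖(T : H →ₗ[ℂ] H) x‖ ≤ 1 * ‖e x‖ := fun x => by
    rw [one_mul, Submodule.coe_norm, he, hN, norm_abs_apply]
    rfl
  -- By `norm_abs_apply`, `|T| x ↦ T x` is well defined and isometric on a dense subspace of `K`.
  let W : K →L[ℂ] H := (T : H →ₗ[ℂ] H).extendOfNorm e
  have hW : ∀ x, W (e x) = T x := fun x => LinearMap.extendOfNorm_eq hd ⟨1, hbd⟩ x
  have hWn : ∀ y, ‖W y‖ = ‖y‖ := fun y => by
    refine hd.induction_on (p := fun y => ‖W y‖ = ‖y‖) y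
      (isClosed_eq (by fun_prop) (by fun_prop)) fun x => ?_
    rw [hW, Submodule.coe_norm, he, hN, norm_abs_apply]
  let V : H →L[ℂ] H := W ∘L K.orthogonalProjectionOnto
  have hVn : ∀ x, ‖V x‖ = ‖K.orthogonalProjectionOnto x‖ := fun x => hWn _
  have hker : V.ker = Kᗮ := by
    ext x
    rw [LinearMap.mem_ker, ContinuousLinearMap.coe_coe, ← norm_eq_zero, hVn, norm_eq_zero,
      Submodule.orthogonalProjectionOnto_eq_zero_iff]
  refine ⟨V, ⟨fun x hx => ?_, ?_, ?_⟩⟩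
  · rw [hker, Submodule.orthogonal_orthogonal] at hx
    rw [hVn, Submodule.coe_norm, Submodule.coe_orthogonalProjectionOnto_apply,
      Submodule.starProjection_eq_self_iff.2 hx]
  · ext x
    change T x = W (K.orthogonalProjectionOnto (N x))
    rw [← he, Submodule.orthogonalProjectionOnto_mem_subspace_eq_self, hW]
  · rw [hker, hsa.orthogonal_topologicalClosure_range, ker_abs]

theorem VonNeumannAlgebra.isPolarFactor_mem {S : VonNeumannAlgebra H} {T V : H →L[ℂ] H}
    (hT : T ∈ S) (hV : IsPolarFactor T V) : V ∈ S :=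
  VonNeumannAlgebra.mem_iff_forall_commute.2 fun _ hA =>
    hV.commute (commute_of_mem_commutant hA hT) (commute_of_mem_commutant hA (star_mem hT))

end PolarDecomposition

/-! ### Operators controlled by their quadratic forms. -/

section QuadraticForm

variable {H : Type*} [NormedAddCommGroup H] [InnerProductSpace ℂ H]

theorem ContinuousLinearMap.ext_inner_self {S T : H →L[ℂ] H}
    (h : ∀ x, ⟪x, S x⟫_ℂ = ⟪x, T x⟫_ℂ) : S = T := by
  refine ContinuousLinearMap.coe_injective ((ext_inner_map _ _).1 fun x => ?_)
  rw [← inner_conj_symm, ← inner_conj_symm (T.toLinearMap x)]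
  exact congrArg _ (h x)

theorem ContinuousLinearMap.isPositive_of_inner_self {T : H →L[ℂ] H} {t : H → ℝ}
    (h : ∀ x, ⟪x, T x⟫_ℂ = (t x : ℂ)) (h0 : ∀ x, 0 ≤ t x) : T.IsPositive := by
  refine (ContinuousLinearMap.isPositive_iff_complex T).2 fun x => ?_
  have : ⟪T x, x⟫_ℂ = (t x : ℂ) := by rw [← inner_conj_symm, h, Complex.conj_ofReal]
  rw [this]
  exact ⟨by simp, by simpa using h0 x⟩

/-- Iterating the bounds gives `s^n ‖QPx‖ ≤ ‖N^n QPx‖ = ‖Q N^n Px‖ ≤ ‖Q‖ r^n ‖Px‖`; let `n → ∞`. -/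
theorem Commute.projection_mul_projection_eq_zero {N P Q : H →L[ℂ] H} (hP : Commute N P)
    (hQ : Commute N Q) {r s : ℝ} (hr : 0 ≤ r) (hrs : r < s)
    (h1 : ∀ x, ‖N (P x)‖ ≤ r * ‖P x‖) (h2 : ∀ x, s * ‖Q x‖ ≤ ‖N (Q x)‖) : Q * P = 0 := by
  have hs : 0 < s := hr.trans_lt hrs
  have cP : ∀ x, N (P x) = P (N x) := fun x => congr($hP.eq x)
  have cQ : ∀ x, N (Q x) = Q (N x) := fun x => congr($hQ.eq x)
  have key : ∀ (n : ℕ) (x : H), s ^ n * ‖Q (P x)‖ ≤ ‖Q‖ * (r ^ n * ‖P x‖) := by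
    intro n
    induction n with
    | zero => intro x; simpa using Q.le_opNorm (P x)
    | succ n ih =>
      intro x
      calc s ^ (n + 1) * ‖Q (P x)‖ = s ^ n * (s * ‖Q (P x)‖) := by ring
        _ ≤ s ^ n * ‖Q (P (N x))‖ := by
          rw [← cP, ← cQ]
          exact mul_le_mul_of_nonneg_left (h2 _) (by positivity)
        _ ≤ ‖Q‖ * (r ^ n * ‖P (N x)‖) := ih _
        _ ≤ ‖Q‖ * (r ^ n * (r * ‖P x‖)) := by
          rw [← cP]
          gcongr
          exact h1 x
        _ = ‖Q‖ * (r ^ (n + 1) * ‖P x‖) := by ring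
  ext x
  have hlim : Filter.Tendsto (fun n : ℕ => ‖Q‖ * ((r / s) ^ n * ‖P x‖)) Filter.atTop (nhds 0) := by
    simpa using ((tendsto_pow_atTop_nhds_zero_of_lt_one (div_nonneg hr hs.le)
      ((div_lt_one hs).2 hrs)).mul_const ‖P x‖).const_mul ‖Q‖
  have hle : ‖Q (P x)‖ ≤ 0 := by
    refine ge_of_tendsto' hlim fun n => ?_
    have := key n x
    rw [div_pow, div_mul_eq_mul_div, mul_div_assoc', le_div_iff₀ (by positivity), mul_comm]
    exact this
  exact norm_le_zero_iff.1 hle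

variable [CompleteSpace H]

theorem ContinuousLinearMap.norm_le_of_inner_self {T : H →L[ℂ] H} {t : H → ℝ} {r : ℝ} (hr : 0 ≤ r)
    (h : ∀ x, ⟪x, T x⟫_ℂ = (t x : ℂ)) (h0 : ∀ x, 0 ≤ t x) (h1 : ∀ x, t x ≤ r * ‖x‖ ^ 2) :
    ‖T‖ ≤ r := by
  have hT : 0 ≤ T := (ContinuousLinearMap.nonneg_iff_isPositive T).2 (isPositive_of_inner_self h h0)
  rw [CStarAlgebra.norm_le_iff_le_algebraMap T hr hT, ContinuousLinearMap.le_def]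
  refine isPositive_of_inner_self (t := fun x => r * ‖x‖ ^ 2 - t x) (fun x => ?_)
    fun x => sub_nonneg.2 (h1 x)
  have h2 : (algebraMap ℝ (H →L[ℂ] H) r - T) x = (r : ℂ) • x - T x := by
    rw [sub_apply, Algebra.algebraMap_eq_smul_one]
    rfl
  rw [h2, inner_sub_right, inner_smul_right, h, inner_self_eq_norm_sq_to_K]
  push_cast
  rfl

theorem IsStarProjection.inner_self_apply {P : H →L[ℂ] H} (hP : IsStarProjection P) (x : H) :
    ⟪x, P x⟫_ℂ = ((‖P x‖ ^ 2 : ℝ) : ℂ) := by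
  have h : ⟪P x, P x⟫_ℂ = ⟪x, P x⟫_ℂ := by
    rw [← ContinuousLinearMap.adjoint_inner_right, ← ContinuousLinearMap.star_eq_adjoint,
      hP.isSelfAdjoint.star_eq, ← mul_apply_eq_comp, hP.isIdempotentElem.eq]
  rw [← h, inner_self_eq_norm_sq_to_K]
  push_cast
  rfl

end QuadraticForm

/-! ### Uniqueness of the spectral measure. -/

namespace SpectralMeasure

variable {H : Type*} [NormedAddCommGroup H] [InnerProductSpace ℂ H] [CompleteSpace H]
variable (E : SpectralMeasure H)

theorem scalarMeasure_apply (x : H) {B : Set ℝ} (hB : MeasurableSet B) :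
    E.scalarMeasure x B = ENNReal.ofReal (‖E.proj B x‖ ^ 2) := by
  rw [scalarMeasure, Measure.ofMeasurable_apply B hB,
    (E.isStarProjection B hB).inner_self_apply, Complex.ofReal_re]

instance isFiniteMeasure_scalarMeasure (x : H) : IsFiniteMeasure (E.scalarMeasure x) :=
  ⟨by rw [E.scalarMeasure_apply x MeasurableSet.univ]; exact ENNReal.ofReal_lt_top⟩

theorem scalarMeasure_real (x : H) {B : Set ℝ} (hB : MeasurableSet B) :
    (E.scalarMeasure x).real B = ‖E.proj B x‖ ^ 2 := by
  rw [measureReal_def, E.scalarMeasure_apply x hB, ENNReal.toReal_ofReal (sq_nonneg _)]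

theorem inner_proj_self (x : H) {B : Set ℝ} (hB : MeasurableSet B) :
    ⟪x, E.proj B x⟫_ℂ = ((E.scalarMeasure x).real B : ℂ) := by
  rw [E.scalarMeasure_real x hB, (E.isStarProjection B hB).inner_self_apply]

variable {E} in
theorem ext_of_scalarMeasure {F : SpectralMeasure H}
    (h : ∀ x, E.scalarMeasure x = F.scalarMeasure x) : E = F := by
  have : E.proj = F.proj := by
    ext1 B
    by_cases hB : MeasurableSet B
    · refine ContinuousLinearMap.ext_inner_self fun x => ?_
      rw [E.inner_proj_self x hB, F.inner_proj_self x hB, h]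
    · rw [E.proj_of_not_measurable B hB, F.proj_of_not_measurable B hB]
  cases E; cases F; congr

theorem scalarMeasure_proj (x : H) {A : Set ℝ} (hA : MeasurableSet A) :
    E.scalarMeasure (E.proj A x) = (E.scalarMeasure x).restrict A := by
  ext B hB
  rw [Measure.restrict_apply hB, E.scalarMeasure_apply _ hB,
    E.scalarMeasure_apply _ (hB.inter hA), E.proj_inter B A hB hA, mul_apply_eq_comp]

theorem proj_compl {A : Set ℝ} (hA : MeasurableSet A) : E.proj Aᶜ = 1 - E.proj A := by
  refine ContinuousLinearMap.ext_inner_self fun x => ?_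
  rw [E.inner_proj_self x hA.compl, sub_apply, inner_sub_right, E.inner_proj_self x hA,
    ← E.proj_univ, E.inner_proj_self x MeasurableSet.univ, measureReal_compl hA]
  push_cast
  rfl

namespace IsSpectralDecompositionOf

variable {E} {M : H →L[ℂ] H} (hE : E.IsSpectralDecompositionOf M)
include hE

theorem integrable_id (x : H) : Integrable (fun t : ℝ => t) (E.scalarMeasure x) :=
  MemLp.integrable one_le_two ((memLp_two_iff_integrable_sq (by fun_prop)).2 (hE x).1)

theorem inner_proj (x : H) {A : Set ℝ} (hA : MeasurableSet A) :
    ⟪E.proj A x, M (E.proj A x)⟫_ℂ = ((∫ t in A, t ∂(E.scalarMeasure x) : ℝ) : ℂ) := by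
  rw [(hE _).2, E.scalarMeasure_proj x hA]

/-- Splitting `∫ t dμ_x` over `A` and its complement shows that `M` is block diagonal with respect
to the projection. -/
theorem commute_proj {A : Set ℝ} (hA : MeasurableSet A) : Commute M (E.proj A) := by
  have hP := E.isStarProjection A hA
  have hid := hP.isIdempotentElem.eq
  have hin : ∀ {B : Set ℝ}, MeasurableSet B → ∀ x, ⟪x, E.proj B (M (E.proj B x))⟫_ℂ =
      ((∫ t in B, t ∂(E.scalarMeasure x) : ℝ) : ℂ) := fun {B} hB x => by
    rw [← hE.inner_proj x hB, ← ContinuousLinearMap.adjoint_inner_right,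
      ← ContinuousLinearMap.star_eq_adjoint, (E.isStarProjection B hB).isSelfAdjoint.star_eq]
  have key : M = E.proj A * M * E.proj A + (1 - E.proj A) * M * (1 - E.proj A) := by
    refine ContinuousLinearMap.ext_inner_self fun x => ?_
    rw [← E.proj_compl hA, add_apply, inner_add_right]
    simp only [mul_apply_eq_comp]
    rw [hin hA, hin hA.compl, ← Complex.ofReal_add, integral_add_compl hA (hE.integrable_id x),
      (hE x).2]
  have h1 : M * E.proj A = E.proj A * M * E.proj A := by
    conv_lhs => rw [key]
    rw [add_mul, mul_assoc _ (1 - E.proj A), hP.isIdempotentElem.one_sub_mul_self, mul_zero,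
      add_zero, mul_assoc, hid]
  have h2 : E.proj A * M = E.proj A * M * E.proj A := by
    conv_lhs => rw [key]
    rw [mul_add, mul_assoc (1 - E.proj A), ← mul_assoc _ (1 - E.proj A),
      hP.isIdempotentElem.mul_one_sub_self, zero_mul, add_zero, ← mul_assoc, ← mul_assoc, hid]
  exact h1.trans h2.symm

theorem isSelfAdjoint : IsSelfAdjoint M := by
  rw [ContinuousLinearMap.isSelfAdjoint_iff_isSymmetric,
    LinearMap.isSymmetric_iff_inner_map_self_real]
  intro x
  have : ⟪M x, x⟫_ℂ = ((∫ t : ℝ, t ∂(E.scalarMeasure x) : ℝ) : ℂ) := by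
    rw [← inner_conj_symm, (hE x).2, Complex.conj_ofReal]
  change (starRingEnd ℂ) ⟪M x, x⟫_ℂ = ⟪M x, x⟫_ℂ
  rw [this, Complex.conj_ofReal]

theorem inner_sub_smul_proj (c : ℝ) (x : H) {A : Set ℝ} (hA : MeasurableSet A) :
    ⟪x, ((M - (c : ℂ) • 1) * E.proj A) x⟫_ℂ =
      ((∫ t in A, (t - c) ∂(E.scalarMeasure x) : ℝ) : ℂ) := by
  have h1 : (M - (c : ℂ) • 1) * E.proj A = E.proj A * M * E.proj A - (c : ℂ) • E.proj A := by
    rw [← (hE.commute_proj hA).eq, mul_assoc, (E.isStarProjection A hA).isIdempotentElem.eq,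
      sub_mul, smul_mul_assoc, one_mul]
  rw [h1, sub_apply, inner_sub_right, mul_assoc, mul_apply_eq_comp, mul_apply_eq_comp,
    ← (E.isStarProjection A hA).isSelfAdjoint.star_eq, ContinuousLinearMap.star_eq_adjoint,
    ContinuousLinearMap.adjoint_inner_right, ← ContinuousLinearMap.star_eq_adjoint,
    (E.isStarProjection A hA).isSelfAdjoint.star_eq, hE.inner_proj x hA, smul_apply,
    inner_smul_right, E.inner_proj_self x hA, integral_sub (hE.integrable_id x).integrableOn
      (integrable_const c), setIntegral_const]
  push_cast
  simp [mul_comm]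

theorem norm_sub_smul_proj_Iic_le {a c : ℝ} (hca : c ≤ a) (hc : c ≤ -‖M‖) (x : H) :
    ‖(M - (c : ℂ) • 1) (E.proj (Set.Iic a) x)‖ ≤ (a - c) * ‖E.proj (Set.Iic a) x‖ := by
  set P := E.proj (Set.Iic a) with hPdef
  have hA : MeasurableSet (Set.Iic a) := measurableSet_Iic
  have hP := E.isStarProjection _ hA
  have hn : ‖(M - (c : ℂ) • 1) * P‖ ≤ a - c := by
    refine ContinuousLinearMap.norm_le_of_inner_self (sub_nonneg.2 hca)
      (fun x => hE.inner_sub_smul_proj c x hA) (fun x => ?_) fun x => ?_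
    -- Positivity comes from `c ≤ -‖M‖`, not from the integrand: the support of `E` is not yet known
    -- to be bounded below by `c`.
    · have h1 : (∫ t in Set.Iic a, (t - c) ∂(E.scalarMeasure x)) =
          (⟪P x, M (P x)⟫_ℂ).re - c * ‖P x‖ ^ 2 := by
        rw [hE.inner_proj x hA, integral_sub (hE.integrable_id x).integrableOn
          (integrable_const c), setIntegral_const, E.scalarMeasure_real x hA, Complex.ofReal_re,
          smul_eq_mul, mul_comm c]
      have h2 : |(⟪P x, M (P x)⟫_ℂ).re| ≤ ‖M‖ * ‖P x‖ ^ 2 :=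
        calc |(⟪P x, M (P x)⟫_ℂ).re| ≤ ‖⟪P x, M (P x)⟫_ℂ‖ := Complex.abs_re_le_norm _
          _ ≤ ‖P x‖ * ‖M (P x)‖ := norm_inner_le_norm _ _
          _ ≤ ‖P x‖ * (‖M‖ * ‖P x‖) := by gcongr; exact M.le_opNorm _
          _ = ‖M‖ * ‖P x‖ ^ 2 := by ring
      have h3 : c * ‖P x‖ ^ 2 ≤ -‖M‖ * ‖P x‖ ^ 2 := by gcongr
      rw [h1]
      linarith [neg_abs_le (⟪P x, M (P x)⟫_ℂ).re]
    · calc (∫ t in Set.Iic a, (t - c) ∂(E.scalarMeasure x))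
          ≤ ∫ t in Set.Iic a, (a - c) ∂(E.scalarMeasure x) :=
            setIntegral_mono_on ((hE.integrable_id x).sub (integrable_const c)).integrableOn
              (integrable_const _).integrableOn hA fun t ht => sub_le_sub_right ht c
        _ = (a - c) * (E.scalarMeasure x).real (Set.Iic a) := by
            rw [setIntegral_const, smul_eq_mul, mul_comm]
        _ ≤ (a - c) * (E.scalarMeasure x).real Set.univ := by
            exact mul_le_mul_of_nonneg_left (measureReal_mono (Set.subset_univ _))
              (sub_nonneg.2 hca)
        _ = (a - c) * ‖x‖ ^ 2 := by
            rw [E.scalarMeasure_real x MeasurableSet.univ, E.proj_univ]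
            rfl
  calc ‖(M - (c : ℂ) • 1) (P x)‖ = ‖((M - (c : ℂ) • 1) * P) (P x)‖ := by
        rw [mul_apply_eq_comp, ← mul_apply_eq_comp P, hP.isIdempotentElem.eq]
    _ ≤ (a - c) * ‖P x‖ := ContinuousLinearMap.le_of_opNorm_le _ hn _

/-- Cauchy–Schwarz applied to `⟨y, (M - c) y⟩ ≥ (b - c) ‖y‖²`. -/
theorem le_norm_sub_smul_proj_Ioi (b c : ℝ) (x : H) :
    (b - c) * ‖E.proj (Set.Ioi b) x‖ ≤ ‖(M - (c : ℂ) • 1) (E.proj (Set.Ioi b) x)‖ := by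
  have hA : MeasurableSet (Set.Ioi b) := measurableSet_Ioi
  have hP := E.isStarProjection _ hA
  set y := E.proj (Set.Ioi b) x with hy
  have hyy : E.proj (Set.Ioi b) y = y := by
    rw [hy, ← mul_apply_eq_comp, hP.isIdempotentElem.eq]
  have h1 : (b - c) * ‖y‖ ^ 2 ≤ ‖y‖ * ‖(M - (c : ℂ) • 1) y‖ :=
    calc (b - c) * ‖y‖ ^ 2 = ∫ t in Set.Ioi b, (b - c) ∂(E.scalarMeasure y) := by
          rw [setIntegral_const, smul_eq_mul, mul_comm, E.scalarMeasure_real y hA, hyy]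
      _ ≤ ∫ t in Set.Ioi b, (t - c) ∂(E.scalarMeasure y) :=
          setIntegral_mono_on (integrable_const _).integrableOn
            ((hE.integrable_id y).sub (integrable_const c)).integrableOn hA
            fun t ht => sub_le_sub_right (le_of_lt ht) c
      _ = (⟪y, (M - (c : ℂ) • 1) y⟫_ℂ).re := by
          rw [← Complex.ofReal_re (∫ t in Set.Ioi b, (t - c) ∂(E.scalarMeasure y)),
            ← hE.inner_sub_smul_proj c y hA, mul_apply_eq_comp, hyy]
      _ ≤ ‖⟪y, (M - (c : ℂ) • 1) y⟫_ℂ‖ := Complex.re_le_norm _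
      _ ≤ ‖y‖ * ‖(M - (c : ℂ) • 1) y‖ := norm_inner_le_norm _ _
  rcases eq_or_ne y 0 with h0 | h0
  · simp [h0]
  · have hpos : 0 < ‖y‖ := norm_pos_iff.2 h0
    refine le_of_mul_le_mul_left ?_ hpos
    calc ‖y‖ * ((b - c) * ‖y‖) = (b - c) * ‖y‖ ^ 2 := by ring
      _ ≤ _ := h1

variable {F : SpectralMeasure H} (hF : F.IsSpectralDecompositionOf M)
include hF

theorem proj_Ioi_mul_proj_Iic {a b : ℝ} (hab : a < b) :
    F.proj (Set.Ioi b) * E.proj (Set.Iic a) = 0 := by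
  have hcomm : ∀ {c : ℝ} {P : H →L[ℂ] H}, Commute M P → Commute (M - (c : ℂ) • 1) P :=
    fun h => h.sub_left ((Commute.one_left _).smul_left _)
  -- The shift `c = min a (-‖M‖)` makes `0 ≤ a - c < b - c`, as the growth comparison requires.
  have hca : min a (-‖M‖) ≤ a := min_le_left _ _
  exact Commute.projection_mul_projection_eq_zero
    (hcomm (hE.commute_proj measurableSet_Iic)) (hcomm (hF.commute_proj measurableSet_Ioi))
    (sub_nonneg.2 hca) (sub_lt_sub_right hab (min a (-‖M‖)))
    (hE.norm_sub_smul_proj_Iic_le hca (min_le_right _ _)) (hF.le_norm_sub_smul_proj_Ioi _ _)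

/-- Countable additivity lets `b` decrease to `a` in the previous orthogonality relation. -/
theorem proj_Iic_mul_proj_Iic (a : ℝ) :
    F.proj (Set.Iic a) * E.proj (Set.Iic a) = E.proj (Set.Iic a) := by
  have h : F.proj (Set.Ioi a) * E.proj (Set.Iic a) = 0 := by
    ext x
    set y := E.proj (Set.Iic a) x with hy
    have hU : Set.Ioi a = ⋃ n : ℕ, Set.Ioi (a + 1 / ((n : ℝ) + 1)) := by
      ext t
      simp only [Set.mem_Ioi, Set.mem_iUnion]
      constructor
      · intro ht
        obtain ⟨n, hn⟩ := exists_nat_one_div_lt (sub_pos.2 ht)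
        exact ⟨n, by linarith⟩
      · rintro ⟨n, hn⟩
        have : 0 < 1 / ((n : ℝ) + 1) := Nat.one_div_pos_of_nat
        linarith
    have h0 : F.scalarMeasure y (Set.Ioi a) = 0 := by
      rw [hU]
      refine measure_iUnion_null fun n => ?_
      have hab : a < a + 1 / ((n : ℝ) + 1) := by
        have : 0 < 1 / ((n : ℝ) + 1) := Nat.one_div_pos_of_nat
        linarith
      rw [F.scalarMeasure_apply y measurableSet_Ioi, hy, ← mul_apply_eq_comp,
        proj_Ioi_mul_proj_Iic hE hF hab]
      simp
    rw [F.scalarMeasure_apply y measurableSet_Ioi, ENNReal.ofReal_eq_zero] at h0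
    have h1 : ‖F.proj (Set.Ioi a) y‖ = 0 := by
      have := le_antisymm h0 (sq_nonneg _)
      exact pow_eq_zero_iff two_ne_zero |>.1 this
    exact norm_eq_zero.1 h1
  rw [← Set.compl_Iic, F.proj_compl measurableSet_Iic, sub_mul, one_mul, sub_eq_zero] at h
  exact h.symm

theorem proj_Iic_eq (a : ℝ) : E.proj (Set.Iic a) = F.proj (Set.Iic a) := by
  have h := congrArg star (proj_Iic_mul_proj_Iic hE hF a)
  rw [star_mul, (E.isStarProjection _ measurableSet_Iic).isSelfAdjoint.star_eq,
    (F.isStarProjection _ measurableSet_Iic).isSelfAdjoint.star_eq] at h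
  exact h.symm.trans (proj_Iic_mul_proj_Iic hF hE a)

theorem unique : E = F := by
  refine ext_of_scalarMeasure fun x => Measure.ext_of_Iic _ _ fun a => ?_
  rw [E.scalarMeasure_apply x measurableSet_Iic, F.scalarMeasure_apply x measurableSet_Iic,
    proj_Iic_eq hE hF]

end IsSpectralDecompositionOf

end SpectralMeasure

/-! ### Weak limits of operators. -/

section WeakLimit

variable {H : Type*} [NormedAddCommGroup H] [InnerProductSpace ℂ H] [CompleteSpace H]

open Filter in
-- Polarization upgrades convergence on the diagonal to convergence of the sesquilinear forms; the
-- limit is bounded by `C`, hence represented by an operator.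
theorem exists_weak_limit {S : ℕ → H →L[ℂ] H} {C : ℝ} (hC : ∀ n, ‖S n‖ ≤ C) {q : H → ℂ}
    (hq : ∀ x, Tendsto (fun n => ⟪x, S n x⟫_ℂ) atTop (nhds (q x))) :
    ∃ T : H →L[ℂ] H, ∀ x y, Tendsto (fun n => ⟪x, S n y⟫_ℂ) atTop (nhds ⟪x, T y⟫_ℂ) := by
  have hconj : ∀ {x y : H} {l : ℂ}, Tendsto (fun n => ⟪x, S n y⟫_ℂ) atTop (nhds l) ↔
      Tendsto (fun n => ⟪S n y, x⟫_ℂ) atTop (nhds (starRingEnd ℂ l)) := fun {x y l} => by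
    constructor <;> intro h
    · simpa only [Function.comp_def, inner_conj_symm] using
        (Complex.continuous_conj.tendsto _).comp h
    · simpa only [Function.comp_def, inner_conj_symm, Complex.conj_conj] using
        (Complex.continuous_conj.tendsto _).comp h
  have hex : ∀ x y, ∃ l, Tendsto (fun n => ⟪x, S n y⟫_ℂ) atTop (nhds l) := fun x y => by
    have hq' := fun x => hconj.1 (hq x)
    obtain ⟨m, hm⟩ : ∃ m, Tendsto (fun n => ⟪S n y, x⟫_ℂ) atTop (nhds m) :=
      ⟨_, (((((hq' (y + x)).sub (hq' (y - x))).sub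
        ((hq' (y + Complex.I • x)).const_mul Complex.I)).add
        ((hq' (y - Complex.I • x)).const_mul Complex.I)).div_const 4).congr
        fun n => (inner_map_polarization' (S n).toLinearMap y x).symm⟩
    exact ⟨starRingEnd ℂ m, hconj.2 (by rwa [Complex.conj_conj])⟩
  choose l hl using hex
  let B₀ : H →ₗ⋆[ℂ] H →ₗ[ℂ] ℂ := LinearMap.mk₂'ₛₗ (starRingEnd ℂ) (RingHom.id ℂ) l
    (fun x x' y => tendsto_nhds_unique (hl _ _)
      (by simpa only [inner_add_left] using (hl x y).add (hl x' y)))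
    (fun c x y => tendsto_nhds_unique (hl _ _)
      (by simpa only [inner_smul_left, smul_eq_mul] using (hl x y).const_mul (starRingEnd ℂ c)))
    (fun x y y' => tendsto_nhds_unique (hl _ _)
      (by simpa only [map_add, inner_add_right] using (hl x y).add (hl x y')))
    (fun c x y => tendsto_nhds_unique (hl _ _)
      (by simpa only [map_smul, inner_smul_right, smul_eq_mul, RingHom.id_apply] using (hl x y).const_mul c))
  have hB₀ : ∀ x y, ‖B₀ x y‖ ≤ C * ‖x‖ * ‖y‖ := fun x y =>
    le_of_tendsto' (hl x y).norm fun n =>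
      calc ‖⟪x, S n y⟫_ℂ‖ ≤ ‖x‖ * ‖S n y‖ := norm_inner_le_norm _ _
        _ ≤ ‖x‖ * (C * ‖y‖) := by gcongr; exact (S n).le_of_opNorm_le (hC n) y
        _ = C * ‖x‖ * ‖y‖ := by ring
  -- The representing operator acts in the left slot of the inner product, hence the adjoint.
  refine ⟨star (InnerProductSpace.continuousLinearMapOfBilin (B₀.mkContinuous₂ C hB₀)),
    fun x y => ?_⟩
  rw [ContinuousLinearMap.star_eq_adjoint, ContinuousLinearMap.adjoint_inner_right,
    InnerProductSpace.continuousLinearMapOfBilin_apply]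
  exact hl x y

theorem Commute.of_weak_limit {S : ℕ → H →L[ℂ] H} {T A : H →L[ℂ] H}
    (h : ∀ x y, Filter.Tendsto (fun n => ⟪x, S n y⟫_ℂ) Filter.atTop (nhds ⟪x, T y⟫_ℂ))
    (hA : ∀ n, Commute (S n) A) : Commute T A := by
  refine ContinuousLinearMap.ext_inner_self fun x => ?_
  refine tendsto_nhds_unique (h x (A x)) ?_
  rw [mul_apply_eq_comp, ← ContinuousLinearMap.adjoint_inner_left]
  refine (h _ x).congr fun n => ?_
  rw [ContinuousLinearMap.adjoint_inner_left]
  exact congr(⟪x, $((hA n).eq.symm) x⟫_ℂ)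

end WeakLimit

/-! ### Scalar measures from the functional calculus. -/

section VectorMeasure

variable {H : Type*} [NormedAddCommGroup H] [InnerProductSpace ℂ H] [CompleteSpace H]

open CompactlySupported

/-- The positive functional `f ↦ ⟨x, f(T) x⟩` on continuous functions on the spectrum of `T`. -/
noncomputable def cfcFunctional {T : H →L[ℂ] H} (hT : IsSelfAdjoint T) (x : H) :
    C_c(spectrum ℝ T, ℝ) →ₚ[ℝ] ℝ :=
  PositiveLinearMap.mk₀
    { toFun := fun f => (⟪x, cfcHom hT f.toContinuousMap x⟫_ℂ).re
      map_add' := fun f g => by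
        have : (f + g).toContinuousMap = f.toContinuousMap + g.toContinuousMap := rfl
        rw [this, map_add, add_apply, inner_add_right, Complex.add_re]
      map_smul' := fun c f => by
        have : (c • f).toContinuousMap = c • f.toContinuousMap := rfl
        rw [this, map_smul, smul_apply, ← Complex.coe_smul, inner_smul_right, Complex.re_ofReal_mul]
        rfl }
    fun f hf => by
      have h : 0 ≤ cfcHom hT f.toContinuousMap := (cfcHom_nonneg_iff hT).2 hf
      exact ((ContinuousLinearMap.nonneg_iff_isPositive _).1 h).re_inner_nonneg_right x

/-- The measure `μ` on `ℝ` with `∫ f dμ = ⟨x, f(T) x⟩` for continuous `f`. -/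
noncomputable def cfcMeasure {T : H →L[ℂ] H} (hT : IsSelfAdjoint T) (x : H) : Measure ℝ :=
  (RealRMK.rieszMeasure (cfcFunctional hT x)).map Subtype.val

variable {T : H →L[ℂ] H} (hT : IsSelfAdjoint T)

instance isFiniteMeasure_cfcMeasure (x : H) : IsFiniteMeasure (cfcMeasure hT x) := by
  have : IsFiniteMeasure (RealRMK.rieszMeasure (cfcFunctional hT x)) :=
    ⟨isCompact_univ.measure_lt_top⟩
  exact Measure.isFiniteMeasure_map _ _

theorem integrable_cfcMeasure (x : H) {f : ℝ → ℝ} (hf : Continuous f) :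
    Integrable f (cfcMeasure hT x) := by
  rw [cfcMeasure, integrable_map_measure hf.aestronglyMeasurable measurable_subtype_coe.aemeasurable]
  exact (hf.comp continuous_subtype_val).integrable_of_hasCompactSupport
    (HasCompactSupport.of_compactSpace _)

theorem inner_cfc_apply (x : H) {f : ℝ → ℝ} (hf : Continuous f) :
    ⟪x, cfc f T x⟫_ℂ = ((∫ t, f t ∂(cfcMeasure hT x) : ℝ) : ℂ) := by
  have h1 : ∫ t, f t ∂(cfcMeasure hT x) = (⟪x, cfc f T x⟫_ℂ).re := by
    rw [cfcMeasure, integral_map measurable_subtype_coe.aemeasurable hf.aestronglyMeasurable,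
      cfc_apply f T hT hf.continuousOn]
    exact RealRMK.integral_rieszMeasure (cfcFunctional hT x)
      (CompactlySupportedContinuousMap.continuousMapEquiv
        ⟨_, hf.continuousOn.domRestrict⟩)
  have h2 : (starRingEnd ℂ) ⟪x, cfc f T x⟫_ℂ = ⟪x, cfc f T x⟫_ℂ := by
    rw [inner_conj_symm, ← ContinuousLinearMap.adjoint_inner_right,
      ← ContinuousLinearMap.star_eq_adjoint, (cfc_predicate f T : IsSelfAdjoint _).star_eq]
  rw [h1, Complex.conj_eq_iff_re.1 h2]

open NNReal in
theorem lintegral_cfcMeasure (x : H) {f : ℝ → ℝ≥0} (hf' : Continuous f) :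
    ∫⁻ t, f t ∂(cfcMeasure hT x) = ENNReal.ofReal (⟪x, cfc (fun t => (f t : ℝ)) T x⟫_ℂ).re := by
  have hf : Continuous fun t => (f t : ℝ) := by fun_prop
  rw [inner_cfc_apply hT x hf, Complex.ofReal_re, ofReal_integral_eq_lintegral_ofReal
    (integrable_cfcMeasure hT x hf) (Filter.Eventually.of_forall fun t => (f t).2)]
  simp

theorem cfcMeasure_real_univ (x : H) : (cfcMeasure hT x).real Set.univ = ‖x‖ ^ 2 := by
  have h := inner_cfc_apply hT x (f := fun _ => 1) continuous_const
  rw [cfc_const_one ℝ T, integral_const, one_apply_eq_self,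
    inner_self_eq_norm_sq_to_K,
    smul_eq_mul, mul_one] at h
  refine Complex.ofReal_injective (h.symm.trans ?_)
  push_cast
  rfl

theorem cfcMeasure_real_le (x : H) (B : Set ℝ) : (cfcMeasure hT x).real B ≤ ‖x‖ ^ 2 :=
  (measureReal_mono (Set.subset_univ _)).trans_eq (cfcMeasure_real_univ hT x)

open BoundedContinuousFunction NNReal in
-- Both sides integrate `k` to `⟨x, (h k h)(T) x⟩`.
theorem cfcMeasure_cfc_apply (x : H) {h : ℝ → ℝ≥0} (hc : Continuous h) :
    cfcMeasure hT (cfc (fun t => (h t : ℝ)) T x) =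
      (cfcMeasure hT x).withDensity fun t => (h t : ENNReal) ^ 2 := by
  have hh : Continuous fun t => (h t : ℝ) := by fun_prop
  refine ext_of_forall_lintegral_eq_of_IsFiniteMeasure fun k => ?_
  have hk : Continuous fun t => (k t : ℝ) := by fun_prop
  have hS : star (cfc (fun t => (h t : ℝ)) T) = cfc (fun t => (h t : ℝ)) T :=
    (cfc_predicate _ T : IsSelfAdjoint _).star_eq
  rw [lintegral_withDensity_eq_lintegral_mul _ (by fun_prop) (by fun_prop),
    lintegral_cfcMeasure hT _ k.continuous]
  have h1 : ∀ t, ((fun t => (h t : ENNReal) ^ 2) * fun t => (k t : ENNReal)) t =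
      ((h t * h t * k t : ℝ≥0) : ENNReal) := fun t => by
    simp [sq]
  rw [lintegral_congr h1, lintegral_cfcMeasure hT x (f := fun t => h t * h t * k t) (by fun_prop)]
  congr 2
  have h2 : cfc (fun t => ((h t * h t * k t : ℝ≥0) : ℝ)) T =
      cfc (fun t => (h t : ℝ)) T * (cfc (fun t => (k t : ℝ)) T * cfc (fun t => (h t : ℝ)) T) := by
    rw [← cfc_mul (fun t => (k t : ℝ)) (fun t => (h t : ℝ)) T hk.continuousOn hh.continuousOn,
      ← cfc_mul (fun t => (h t : ℝ)) (fun t => (k t : ℝ) * h t) T hh.continuousOn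
        (hk.mul hh).continuousOn]
    congr 1
    ext t
    simp only [NNReal.coe_mul]
    ring
  rw [h2, mul_apply_eq_comp, mul_apply_eq_comp]
  have h3 := ContinuousLinearMap.adjoint_inner_right (cfc (fun t => (h t : ℝ)) T) x
    (cfc (fun t => (k t : ℝ)) T (cfc (fun t => (h t : ℝ)) T x))
  rwa [← ContinuousLinearMap.star_eq_adjoint, hS, eq_comm] at h3

end VectorMeasure

/-! ### Existence of the spectral measure. -/

section SpectralProjection

variable {H : Type*} [NormedAddCommGroup H] [InnerProductSpace ℂ H] [CompleteSpace H]
variable {T : H →L[ℂ] H} (hT : IsSelfAdjoint T)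

theorem hasSum_measureReal {α : Type*} [MeasurableSpace α] (μ : Measure α) [IsFiniteMeasure μ]
    {B : ℕ → Set α} (hB : ∀ n, MeasurableSet (B n)) (hd : Pairwise (Function.onFun Disjoint B)) :
    HasSum (fun n => μ.real (B n)) (μ.real (⋃ n, B n)) := by
  have h := measure_iUnion (μ := μ) hd hB
  rw [measureReal_def, h, ENNReal.tsum_toReal_eq fun n => measure_ne_top μ _]
  have := ENNReal.hasSum_toReal (f := fun n => μ (B n)) (h ▸ measure_ne_top μ _)
  exact this

theorem exists_operator_of_tendsto {B : Set ℝ} {S : ℕ → H →L[ℂ] H} {t : ℕ → H → ℝ}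
    (hS : ∀ n x, ⟪x, S n x⟫_ℂ = (t n x : ℂ)) (h0 : ∀ n x, 0 ≤ t n x)
    (h1 : ∀ n x, t n x ≤ ‖x‖ ^ 2)
    (hlim : ∀ x, Filter.Tendsto (fun n => t n x) Filter.atTop (nhds ((cfcMeasure hT x).real B)))
    (hc : ∀ n A, Commute T A → Commute (S n) A) :
    ∃ P : H →L[ℂ] H, (∀ x, ⟪x, P x⟫_ℂ = ((cfcMeasure hT x).real B : ℂ)) ∧
      ∀ A, Commute T A → Commute P A := by
  have hl : ∀ x, Filter.Tendsto (fun n => ⟪x, S n x⟫_ℂ) Filter.atTop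
      (nhds ((cfcMeasure hT x).real B : ℂ)) := fun x => by
    simp_rw [hS]
    exact (Complex.continuous_ofReal.tendsto _).comp (hlim x)
  obtain ⟨P, hP⟩ := exists_weak_limit (fun n => ContinuousLinearMap.norm_le_of_inner_self
    zero_le_one (hS n) (h0 n) fun x => (one_mul (‖x‖ ^ 2)).symm ▸ h1 n x) hl
  exact ⟨P, fun x => tendsto_nhds_unique (hP x x) (hl x),
    fun A hA => Commute.of_weak_limit hP fun n => hc n A hA⟩

/-- Induction on Borel sets: closed sets are reached by continuous approximations, complements by `1
- P`, disjoint unions by partial sums. Commutation is carried along, since multiplicativity and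
membership in `𝓜` both need it. -/
theorem exists_spectral_operator {B : Set ℝ} (hB : MeasurableSet B) :
    ∃ P : H →L[ℂ] H, (∀ x, ⟪x, P x⟫_ℂ = ((cfcMeasure hT x).real B : ℂ)) ∧
      ∀ A, Commute T A → Commute P A := by
  have hcompl : ∀ {B : Set ℝ}, MeasurableSet B →
      (∃ P : H →L[ℂ] H, (∀ x, ⟪x, P x⟫_ℂ = ((cfcMeasure hT x).real B : ℂ)) ∧
        ∀ A, Commute T A → Commute P A) →
      ∃ P : H →L[ℂ] H, (∀ x, ⟪x, P x⟫_ℂ = ((cfcMeasure hT x).real Bᶜ : ℂ)) ∧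
        ∀ A, Commute T A → Commute P A := by
    rintro B hB ⟨P, hP, hPc⟩
    refine ⟨1 - P, fun x => ?_, fun A hA => (Commute.one_left A).sub_left (hPc A hA)⟩
    rw [sub_apply, one_apply_eq_self, inner_sub_right, hP, inner_self_eq_norm_sq_to_K,
      measureReal_compl hB, cfcMeasure_real_univ]
    push_cast
    rfl
  have hclosed : ∀ {B : Set ℝ}, IsClosed B →
      ∃ P : H →L[ℂ] H, (∀ x, ⟪x, P x⟫_ℂ = ((cfcMeasure hT x).real B : ℂ)) ∧
        ∀ A, Commute T A → Commute P A := by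
    intro B hB
    have hcont : ∀ n, Continuous fun s => (hB.apprSeq n s : ℝ) := fun n => by fun_prop
    refine exists_operator_of_tendsto hT (S := fun n => cfc (fun s => (hB.apprSeq n s : ℝ)) T)
      (t := fun n x => ∫ s, (hB.apprSeq n s : ℝ) ∂(cfcMeasure hT x))
      (fun n x => inner_cfc_apply hT x (hcont n))
      (fun n x => integral_nonneg fun s => NNReal.coe_nonneg _)
      (fun n x => ?_) (fun x => ?_) fun n A hA => hA.cfc_real _
    · calc ∫ s, (hB.apprSeq n s : ℝ) ∂(cfcMeasure hT x) ≤ ∫ _, (1 : ℝ) ∂(cfcMeasure hT x) :=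
            integral_mono (integrable_cfcMeasure hT x (hcont n)) (integrable_const _) fun s =>
              NNReal.coe_le_one.2 (HasOuterApproxClosed.apprSeq_apply_le_one hB n s)
        _ = ‖x‖ ^ 2 := by rw [integral_const, cfcMeasure_real_univ, smul_eq_mul, mul_one]
    · have h := (ENNReal.tendsto_toReal (measure_ne_top (cfcMeasure hT x) B)).comp
        (HasOuterApproxClosed.tendsto_lintegral_apprSeq hB (cfcMeasure hT x))
      refine h.congr fun n => ?_
      rw [integral_eq_lintegral_of_nonneg_ae
        (Filter.Eventually.of_forall fun s => NNReal.coe_nonneg _) (hcont n).aestronglyMeasurable]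
      simp
  induction B, hB using MeasurableSet.induction_on_open with
  | isOpen U hU =>
    rw [← compl_compl U]
    exact hcompl hU.measurableSet.compl (hclosed hU.isClosed_compl)
  | compl B hB ih => exact hcompl hB ih
  | iUnion B hd hB ih =>
    choose P hP hPc using ih
    have hsum := fun x => hasSum_measureReal (cfcMeasure hT x) hB hd
    refine exists_operator_of_tendsto hT (S := fun n => ∑ i ∈ Finset.range n, P i)
      (t := fun n x => ∑ i ∈ Finset.range n, (cfcMeasure hT x).real (B i))
      (fun n x => ?_) (fun n x => Finset.sum_nonneg fun i _ => measureReal_nonneg)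
      (fun n x => (sum_le_hasSum _ (fun i _ => measureReal_nonneg) (hsum x)).trans
        (cfcMeasure_real_le hT x _))
      (fun x => (hsum x).tendsto_sum_nat)
      fun n A hA => Commute.sum_left _ _ _ fun i _ => hPc i A hA
    rw [sum_apply, inner_sum, Complex.ofReal_sum]
    exact Finset.sum_congr rfl fun i _ => hP i x

open Classical in
/-- The spectral projection of `T` on a Borel set, and `0` on other sets. -/
noncomputable def cfcProj (B : Set ℝ) : H →L[ℂ] H :=
  if hB : MeasurableSet B then (exists_spectral_operator hT hB).choose else 0

theorem cfcProj_of_not_measurableSet {B : Set ℝ} (hB : ¬ MeasurableSet B) : cfcProj hT B = 0 :=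
  dif_neg hB

theorem inner_cfcProj {B : Set ℝ} (hB : MeasurableSet B) (x : H) :
    ⟪x, cfcProj hT B x⟫_ℂ = ((cfcMeasure hT x).real B : ℂ) := by
  rw [cfcProj, dif_pos hB]
  exact (exists_spectral_operator hT hB).choose_spec.1 x

theorem commute_cfcProj {B : Set ℝ} (hB : MeasurableSet B) {A : H →L[ℂ] H} (hA : Commute T A) :
    Commute (cfcProj hT B) A := by
  rw [cfcProj, dif_pos hB]
  exact (exists_spectral_operator hT hB).choose_spec.2 A hA

theorem cfcProj_nonneg {B : Set ℝ} (hB : MeasurableSet B) : 0 ≤ cfcProj hT B :=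
  (ContinuousLinearMap.nonneg_iff_isPositive _).2
    (ContinuousLinearMap.isPositive_of_inner_self (inner_cfcProj hT hB)
      fun _ => measureReal_nonneg)

theorem commute_sqrt_cfcProj {B : Set ℝ} (hB : MeasurableSet B) {A : H →L[ℂ] H}
    (hA : Commute T A) : Commute (CFC.sqrt (cfcProj hT B)) A :=
  (commute_cfcProj hT hB hA).cfcₙ_nnreal _

theorem inner_sqrt_cfcProj {B : Set ℝ} (x y : H) :
    ⟪CFC.sqrt (cfcProj hT B) x, y⟫_ℂ = ⟪x, CFC.sqrt (cfcProj hT B) y⟫_ℂ := by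
  rw [← ContinuousLinearMap.adjoint_inner_right, ← ContinuousLinearMap.star_eq_adjoint,
    (CFC.sqrt_nonneg (cfcProj hT B)).isSelfAdjoint.star_eq]

theorem sqrt_cfcProj_mul_self {B : Set ℝ} (hB : MeasurableSet B) :
    CFC.sqrt (cfcProj hT B) * CFC.sqrt (cfcProj hT B) = cfcProj hT B :=
  CFC.sqrt_mul_sqrt_self _ (cfcProj_nonneg hT hB)

/-- The square root stands in for the projection, whose idempotence is not yet available. With `S =
√P_B` and `L = √k(T)`, commutation gives `⟨Sx, k(T) Sx⟩ = ⟨Lx, P_B Lx⟩ = μ_{Lx}(B) = ∫_B k dμ_x`. -/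
theorem cfcMeasure_sqrt_cfcProj {B : Set ℝ} (hB : MeasurableSet B) (x : H) :
    cfcMeasure hT (CFC.sqrt (cfcProj hT B) x) = (cfcMeasure hT x).restrict B := by
  refine ext_of_forall_lintegral_eq_of_IsFiniteMeasure fun k => ?_
  let h : ℝ → NNReal := fun s => NNReal.sqrt (k s)
  have hh : Continuous h := NNReal.continuous_sqrt.comp k.continuous
  have hh' : Continuous fun s => (h s : ℝ) := by fun_prop
  set S := CFC.sqrt (cfcProj hT B) with hS
  set L := cfc (fun s => (h s : ℝ)) T with hL
  have hLL : cfc (fun s => (k s : ℝ)) T = L * L := by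
    rw [hL, ← cfc_mul _ _ T hh'.continuousOn hh'.continuousOn]
    congr 1
    ext s
    rw [← NNReal.coe_mul, NNReal.mul_self_sqrt]
  have hLs : star L = L := (cfc_predicate _ T : IsSelfAdjoint _).star_eq
  have hSL : S * L = L * S := commute_sqrt_cfcProj hT hB ((Commute.refl T).cfc_real _).symm
  have hop : S * (L * L * S) = L * (cfcProj hT B * L) := by
    rw [← sqrt_cfcProj_mul_self hT hB, ← hS]
    calc S * (L * L * S) = S * L * (L * S) := by simp only [mul_assoc]
      _ = L * S * (S * L) := by rw [hSL]
      _ = L * (S * S * L) := by simp only [mul_assoc]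
  have hin : ⟪S x, cfc (fun s => (k s : ℝ)) T (S x)⟫_ℂ = ⟪L x, cfcProj hT B (L x)⟫_ℂ :=
    calc ⟪S x, cfc (fun s => (k s : ℝ)) T (S x)⟫_ℂ = ⟪x, (S * (L * L * S)) x⟫_ℂ := by
          rw [hLL, hS, inner_sqrt_cfcProj]
          rfl
      _ = ⟪x, L (cfcProj hT B (L x))⟫_ℂ := by rw [hop]; rfl
      _ = ⟪L x, cfcProj hT B (L x)⟫_ℂ := by
          rw [← ContinuousLinearMap.adjoint_inner_right L, ← ContinuousLinearMap.star_eq_adjoint,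
            hLs]
  rw [lintegral_cfcMeasure hT _ k.continuous, hin, inner_cfcProj hT hB, Complex.ofReal_re, hL,
    ofReal_measureReal, cfcMeasure_cfc_apply hT x hh, withDensity_apply _ hB]
  refine lintegral_congr fun s => ?_
  rw [← ENNReal.coe_pow, NNReal.sq_sqrt]

theorem cfcProj_inter {A B : Set ℝ} (hA : MeasurableSet A) (hB : MeasurableSet B) :
    cfcProj hT (A ∩ B) = cfcProj hT A * cfcProj hT B := by
  refine ContinuousLinearMap.ext_inner_self fun x => ?_
  have hTA : Commute T (cfcProj hT A) := (commute_cfcProj hT hA (Commute.refl T)).symm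
  have hop : cfcProj hT A * cfcProj hT B =
      CFC.sqrt (cfcProj hT B) * cfcProj hT A * CFC.sqrt (cfcProj hT B) := by
    rw [(commute_sqrt_cfcProj hT hB hTA).eq, mul_assoc, sqrt_cfcProj_mul_self hT hB]
  rw [inner_cfcProj hT (hA.inter hB), ← measureReal_restrict_apply hA,
    ← cfcMeasure_sqrt_cfcProj hT hB, ← inner_cfcProj hT hA, inner_sqrt_cfcProj, hop]
  rfl

theorem isStarProjection_cfcProj {B : Set ℝ} (hB : MeasurableSet B) :
    IsStarProjection (cfcProj hT B) :=
  ⟨by rw [IsIdempotentElem, ← cfcProj_inter hT hB hB, Set.inter_self],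
    (cfcProj_nonneg hT hB).isSelfAdjoint⟩

theorem norm_cfcProj_apply_sq {B : Set ℝ} (hB : MeasurableSet B) (x : H) :
    ‖cfcProj hT B x‖ ^ 2 = (cfcMeasure hT x).real B :=
  Complex.ofReal_injective
    (((isStarProjection_cfcProj hT hB).inner_self_apply x).symm.trans (inner_cfcProj hT hB x))

theorem cfcProj_univ : cfcProj hT Set.univ = 1 := by
  refine ContinuousLinearMap.ext_inner_self fun x => ?_
  rw [inner_cfcProj hT MeasurableSet.univ, cfcMeasure_real_univ, one_apply_eq_self,
    inner_self_eq_norm_sq_to_K]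
  push_cast
  rfl

theorem cfcProj_empty : cfcProj hT ∅ = 0 := by
  refine ContinuousLinearMap.ext_inner_self fun x => ?_
  rw [inner_cfcProj hT MeasurableSet.empty]
  simp

theorem hasSum_cfcProj {B : ℕ → Set ℝ} (hB : ∀ n, MeasurableSet (B n))
    (hd : Pairwise (Function.onFun Disjoint B)) (x : H) :
    HasSum (fun n => cfcProj hT (B n) x) (cfcProj hT (⋃ n, B n) x) := by
  have hU : MeasurableSet (⋃ n, B n) := MeasurableSet.iUnion hB
  -- The error of a partial sum is the projection of the remaining set applied to `x`, so its
  -- squared norm is a tail of a convergent series.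
  have key : ∀ s : Finset ℕ, ‖(∑ n ∈ s, cfcProj hT (B n) x) - cfcProj hT (⋃ n, B n) x‖ ^ 2 =
      (cfcMeasure hT x).real (⋃ n, B n) - ∑ n ∈ s, (cfcMeasure hT x).real (B n) := by
    intro s
    have hs : MeasurableSet (⋃ n ∈ s, B n) := Finset.measurableSet_biUnion s fun n _ => hB n
    have hsub : (⋃ n ∈ s, B n) ⊆ ⋃ n, B n := Set.iUnion₂_subset_iUnion _ _
    have hreal : ∀ y, (cfcMeasure hT y).real ((⋃ n, B n) \ ⋃ n ∈ s, B n) =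
        (cfcMeasure hT y).real (⋃ n, B n) - ∑ n ∈ s, (cfcMeasure hT y).real (B n) := fun y => by
      rw [measureReal_sdiff hsub hs, measureReal_biUnion_finset (hd.set_pairwise _) fun n _ => hB n]
    have hop : cfcProj hT ((⋃ n, B n) \ ⋃ n ∈ s, B n) =
        cfcProj hT (⋃ n, B n) - ∑ n ∈ s, cfcProj hT (B n) := by
      refine ContinuousLinearMap.ext_inner_self fun y => ?_
      rw [inner_cfcProj hT (hU.diff hs), hreal, sub_apply, sum_apply, inner_sub_right, inner_sum,
        inner_cfcProj hT hU, Finset.sum_congr rfl fun n _ => inner_cfcProj hT (hB n) y]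
      push_cast
      rfl
    rw [← hreal, ← norm_cfcProj_apply_sq hT (hU.diff hs), hop, sub_apply, sum_apply, norm_sub_rev]
  have hlim : Filter.Tendsto (fun s : Finset ℕ => (cfcMeasure hT x).real (⋃ n, B n) -
      ∑ n ∈ s, (cfcMeasure hT x).real (B n)) Filter.atTop (nhds 0) := by
    have h := (hasSum_measureReal (cfcMeasure hT x) hB hd).const_sub
      ((cfcMeasure hT x).real (⋃ n, B n))
    rwa [sub_self] at h
  rw [HasSum, SummationFilter.unconditional_filter, tendsto_iff_norm_sub_tendsto_zero]
  have h2 := (Real.continuous_sqrt.tendsto _).comp hlim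
  rw [Real.sqrt_zero] at h2
  refine h2.congr fun s => ?_
  rw [Function.comp_apply, ← key, Real.sqrt_sq (norm_nonneg _)]

/-- The spectral measure of a bounded self-adjoint operator. -/
noncomputable def spectralMeasureOf : SpectralMeasure H where
  proj := cfcProj hT
  isStarProjection _ hB := isStarProjection_cfcProj hT hB
  proj_empty := cfcProj_empty hT
  proj_univ := cfcProj_univ hT
  proj_inter _ _ hA hB := cfcProj_inter hT hA hB
  hasSum_proj _ hB hd x := hasSum_cfcProj hT hB hd x
  proj_of_not_measurable _ hB := cfcProj_of_not_measurableSet hT hB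

theorem scalarMeasure_spectralMeasureOf (x : H) :
    (spectralMeasureOf hT).scalarMeasure x = cfcMeasure hT x := by
  ext B hB
  rw [SpectralMeasure.scalarMeasure_apply _ x hB]
  change ENNReal.ofReal (‖cfcProj hT B x‖ ^ 2) = _
  rw [norm_cfcProj_apply_sq hT hB, ofReal_measureReal]

theorem isSpectralDecompositionOf_spectralMeasureOf :
    (spectralMeasureOf hT).IsSpectralDecompositionOf T := by
  intro x
  rw [scalarMeasure_spectralMeasureOf]
  refine ⟨integrable_cfcMeasure hT x (by fun_prop), ?_⟩
  rw [← inner_cfc_apply hT x continuous_id', cfc_id' ℝ T]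

/-- Uniqueness identifies `E` with the constructed measure, whose projections commute with
everything that commutes with `T`. -/
theorem SpectralMeasure.IsSpectralDecompositionOf.proj_mem {E : SpectralMeasure H}
    (hE : E.IsSpectralDecompositionOf T) {S : VonNeumannAlgebra H} (hTS : T ∈ S)
    {B : Set ℝ} (hB : MeasurableSet B) : E.proj B ∈ S := by
  rw [hE.unique (isSpectralDecompositionOf_spectralMeasureOf hE.isSelfAdjoint)]
  exact VonNeumannAlgebra.mem_iff_forall_commute.2 fun A hA =>
    (commute_cfcProj hE.isSelfAdjoint hB
      (VonNeumannAlgebra.commute_of_mem_commutant hA hTS).symm).symm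

end SpectralProjection

theorem mainTheorem1 {H : Type*} [NormedAddCommGroup H] [InnerProductSpace ℂ H] [CompleteSpace H]
    (𝓜 : VonNeumannAlgebra H) (M : H →L[ℂ] H) (hM : M ∈ 𝓜) :
    ((∃! V : H →L[ℂ] H, IsPolarFactor M V) ∧
      (∀ V : H →L[ℂ] H, IsPolarFactor M V → V ∈ 𝓜) ∧ CFC.abs M ∈ 𝓜) ∧
    (IsSelfAdjoint M →
      (∃! E : SpectralMeasure H, E.IsSpectralDecompositionOf M) ∧
      ∀ E : SpectralMeasure H, E.IsSpectralDecompositionOf M →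
        ∀ B : Set ℝ, MeasurableSet B → E.proj B ∈ 𝓜) ∧
    (IsSelfAdjoint M → ∀ f : ℝ → ℂ, ContinuousOn f (Set.Icc (-‖M‖) ‖M‖) →
      (∀ A : NonUnitalStarSubalgebra ℂ (H →L[ℂ] H), IsClosed (A : Set (H →L[ℂ] H)) →
        M ∈ A → (1 ∈ A ∨ f 0 = 0) → continuousFunctionOf f M ∈ A) ∧
      continuousFunctionOf f M ∈ 𝓜) := by
  refine ⟨⟨?_, fun V hV => VonNeumannAlgebra.isPolarFactor_mem hM hV,
    VonNeumannAlgebra.abs_mem hM⟩, fun hsa => ⟨?_, fun E hE B hB => hE.proj_mem hM hB⟩,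
    fun _ f hf => ⟨fun A hA hMA h => ?_, VonNeumannAlgebra.continuousFunctionOf_mem hM f⟩⟩
  · obtain ⟨V, hV⟩ := exists_isPolarFactor M
    exact ⟨V, hV, fun W hW => hW.unique hV⟩
  · exact ⟨spectralMeasureOf hsa, isSpectralDecompositionOf_spectralMeasureOf hsa,
      fun E hE => hE.unique (isSpectralDecompositionOf_spectralMeasureOf hsa)⟩
  · rcases h with h1 | h0
    · exact continuousFunctionOf_mem_of_one_mem f hA hMA h1
    · exact continuousFunctionOf_mem_of_apply_zero hf h0 hA hMA
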